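/- Let $\mathbb F_q$ be a finite field of characteristic $p$, let $m\ge 1$ with $\gcd(m,q)=1$, and let $c,f\ge 0$, $n=cm+f$. Let $\sigma=\Omega_1\cdots\Omega_{c+f}\in\mathrm{Sym}(n)$ be the permutation of type $m$-$(c,f)$, where $\Omega_i=((i-1)m+1,\dots,im)$ for $1\le i\le c$ and $\Omega_{c+i}=(cm+i)$ for $1\le i\le f$, and let $C\subseteq\mathbb F_q^n$ be a linear code invariant under $\sigma$ (an almost quasi-cyclic code). A code $D$ is LCD with respect to an inner product if $D\cap D^\perp=\{\mathbf 0\}$. Let $F_\sigma(C)=\{v\in C: v\sigma=v\}$, let $C_\pi\subseteq \mathbb F_q^{c+f}$ be the code obtained from $F_\sigma(C)$ by keeping one coordinate from each $\Omega_i$, and let $E_\sigma(C)^*\subseteq\mathbb F_q^{cm}$ be obtained from $E_\sigma(C)=\{v\in C:\sum_{j\in\Omega_i}v_j=0\text{ for all } i\}$ by deleting the last $f$ coordinates. Let $\mathcal R_m=\mathbb F_q[x]/(x^m-1)$, with the conjugation $\overline{a(x)}=a(x^{-1})=a(x^{m-1})$, and let $$x^m-1=\delta\,(x-1)\,g_1\cdots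 g_r\,h_1h_1^*\cdots h_th_t^*,\qquad \delta\in\mathbb F_q^*,$$ be a factorization into irreducible polynomials, where each $g_i$ is associated with its reciprocal polynomial and $h_j^*$ is the reciprocal polynomial of $h_j$. Let $G_i,H_j',H_j''$ be the (minimal) ideals of $\mathcal R_m$ generated by $\frac{x^m-1}{g_i},\frac{x^m-1}{h_j},\frac{x^m-1}{h_j^*}$. Let $\phi:\mathbb F_q^{cm}\to\mathcal R_m^c$ send each block $(a_0,\dots,a_{m-1})$ to $a_0+a_1x+\dots+a_{m-1}x^{m-1}$, and let $C_i$, $C_j'$, $C_j''$ be the components of $\phi(E_\sigma(C)^*)$ in $G_i^c$, $(H_j')^c$, $(H_j'')^c$, that is, its intersections with these. Consider the conditions: (i) for $i=1,\dots,r$ the code $C_i$ over $G_i$ is LCD for the Hermitian inner product $(u,v)=\sum_k u_k\overline{v_k}$; (ii) for $j=1,\dots,t$, $C_j''\cap(C_j')^\perp=\{\mathbf 0\}$ and $C_j'\cap(C_j'')^\perp=\{\mathbf 0\}$ for the Euclidean inner product, where $H_j'$ and $H_j''$ are identified by the conjugation, which exchanges them. Then: (a) $C$ is Euclidean LCD if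 and only if $F_\sigma(C)$ is Euclidean LCD and (i) and (ii) hold. (b) If all cycle lengths of $\sigma$ are congruent modulo $p$, in the sense that $f=0$ or $m\equiv 1\pmod p$, then $C$ is Euclidean LCD if and only if $C_\pi$ is Euclidean LCD and (i) and (ii) hold. -/

import Mathlib

open Polynomial

noncomputable section

namespace AQC

/-! ### Linear codes over a field, indexed by a finite set of coordinates -/

section Codes

variable {F : Type*} [Field F] {ι : Type*} [Fintype ι]

/-- The Euclidean dual code. -/
def dual (C : Submodule F (ι → F)) : Submodule F (ι → F) where
  carrier := {u | ∀ v ∈ C, u ⬝ᵥ v = 0}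
  zero_mem' := fun v _ => zero_dotProduct v
  add_mem' := by
    intro a b ha hb v hv
    rw [add_dotProduct, ha v hv, hb v hv, add_zero]
  smul_mem' := by
    intro r a ha v hv
    rw [smul_dotProduct, ha v hv, smul_zero]

/-- `C` is Euclidean LCD: `C ∩ C^⊥ = {0}`. -/
def IsEuclideanLCD (C : Submodule F (ι → F)) : Prop :=
  C ⊓ dual C = ⊥

/-- `σ` is a permutation automorphism of the code `C`. -/
def IsPermAut (σ : Equiv.Perm ι) (C : Submodule F (ι → F)) : Prop :=
  ∀ v, v ∈ C ↔ v ∘ σ ∈ C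

/-- The fixed subcode `F_σ(C)`. -/
def fixedSubcode (σ : Equiv.Perm ι) (C : Submodule F (ι → F)) : Submodule F (ι → F) where
  carrier := {v | v ∈ C ∧ v ∘ σ = v}
  zero_mem' := ⟨C.zero_mem, rfl⟩
  add_mem' := by
    rintro a b ⟨ha, ha'⟩ ⟨hb, hb'⟩
    exact ⟨C.add_mem ha hb, by rw [Pi.add_comp, ha', hb']⟩
  smul_mem' := by
    rintro r a ⟨ha, ha'⟩
    exact ⟨C.smul_mem r ha, by rw [Pi.smul_comp, ha']⟩

open Classical in
/-- The subcode `E_σ(C)` of codewords whose coordinates sum to zero over each cycle of `σ`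
(fixed points being cycles of length one). -/
def zeroSumSubcode (σ : Equiv.Perm ι) (C : Submodule F (ι → F)) : Submodule F (ι → F) where
  carrier := {v | v ∈ C ∧ ∀ i, ∑ j with σ.SameCycle i j, v j = 0}
  zero_mem' := ⟨C.zero_mem, fun i => by simp⟩
  add_mem' := by
    rintro a b ⟨ha, ha'⟩ ⟨hb, hb'⟩
    refine ⟨C.add_mem ha hb, fun i => ?_⟩
    simp only [Pi.add_apply]
    rw [Finset.sum_add_distrib, ha' i, hb' i, add_zero]
  smul_mem' := by
    rintro r a ⟨ha, ha'⟩
    refine ⟨C.smul_mem r ha, fun i => ?_⟩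
    simp only [Pi.smul_apply]
    rw [← Finset.smul_sum, ha' i, smul_zero]

end Codes

/-! ### Permutations of type `m`-`(c,f)` -/

/-- The `n = cm + f` coordinates: `c` blocks of `m` coordinates followed by `f` coordinates. -/
abbrev Coord (m c f : ℕ) : Type := (Fin c × Fin m) ⊕ Fin f

/-- The permutation `Ω_1 ⋯ Ω_c Ω_{c+1} ⋯ Ω_{c+f}` which rotates each of the `c` blocks
cyclically and fixes the last `f` coordinates. -/
def perm (m c f : ℕ) : Equiv.Perm (Coord m c f) :=
  Equiv.sumCongr (Equiv.prodCongr (Equiv.refl (Fin c)) (finRotate m)) (Equiv.refl (Fin f))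

section AlmostQuasiCyclic

variable {F : Type*} [Field F] {m c f : ℕ}

/-- The map reading off one coordinate from each of the `c + f` cycles; on vectors fixed by the
permutation, the choice of the coordinate does not matter. -/
def proj [NeZero m] : (Coord m c f → F) →ₗ[F] (Fin c ⊕ Fin f → F) :=
  LinearMap.funLeft F F (Sum.map (fun i => (i, (0 : Fin m))) id)

/-- The projection code `C_π = π(F_σ(C))`. -/
def projCode [NeZero m] (C : Submodule F (Coord m c f → F)) :
    Submodule F (Fin c ⊕ Fin f → F) :=
  (fixedSubcode (perm m c f) C).map proj

/-- The code `E_σ(C)^*`: delete the last `f` coordinates from `E_σ(C)`. -/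
def zeroSumPunctured (C : Submodule F (Coord m c f → F)) : Submodule F (Fin c × Fin m → F) :=
  (zeroSumSubcode (perm m c f) C).map (LinearMap.funLeft F F Sum.inl)

end AlmostQuasiCyclic

/-! ### The ring `F[x]/(x^m - 1)` and the constituents -/

section Constituents

variable (F : Type*) [Field F] (m : ℕ)

/-- The ring `R_m = F[x]/(x^m - 1)`. -/
abbrev CycRing : Type _ := AdjoinRoot (X ^ m - 1 : F[X])

/-- The class of `x` in `R_m`. -/
def xbar : CycRing F m := AdjoinRoot.root (X ^ m - 1 : F[X])

theorem xbar_pow : xbar F m ^ m = 1 := by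
  have h := AdjoinRoot.eval₂_root (X ^ m - 1 : F[X])
  rw [eval₂_sub, eval₂_pow, eval₂_X, eval₂_one] at h
  exact sub_eq_zero.mp h

/-- The conjugation `v(x) ↦ v(x^{-1}) = v(x^{m-1})` of `R_m`. -/
def conj : CycRing F m →ₐ[F] CycRing F m :=
  AdjoinRoot.liftAlgHom (X ^ m - 1 : F[X]) (Algebra.ofId F (CycRing F m)) (xbar F m ^ (m - 1)) (by
    rw [eval₂_sub, eval₂_pow, eval₂_X, eval₂_one, ← pow_mul, mul_comm, pow_mul, xbar_pow,
      one_pow, sub_self])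

variable {F m} {c : ℕ}

/-- The map `φ : F^{cm} → R_m^c`, `φ(v) = (∑_j v_{1j} x^j, …, ∑_j v_{cj} x^j)`. -/
def phi : (Fin c × Fin m → F) →ₗ[F] (Fin c → CycRing F m) where
  toFun v i := ∑ j : Fin m, v (i, j) • xbar F m ^ (j : ℕ)
  map_add' u v := by
    funext i
    simp [add_smul, Finset.sum_add_distrib]
  map_smul' r v := by
    funext i
    simp [Finset.smul_sum, mul_smul]

variable (m) in
/-- The ideal of `R_m` generated by `(x^m - 1)/g(x)`; for an irreducible factor `g` of `x^m - 1`
with `m` prime to the characteristic this is a minimal ideal, and a field isomorphic to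
`F[x]/(g)`. -/
def minIdeal (g : F[X]) : Ideal (CycRing F m) :=
  Ideal.span {AdjoinRoot.mk (X ^ m - 1 : F[X]) ((X ^ m - 1) / g)}

/-- The set `I^c` of vectors of length `c` with entries in the ideal `I`, as an `F`-space. -/
def vectorsIn (I : Ideal (CycRing F m)) : Submodule F (Fin c → CycRing F m) :=
  Submodule.pi Set.univ (fun _ => I.restrictScalars F)

/-- The constituent of the code `D` that belongs to the factor `g` of `x^m - 1`: the component
`φ(D) ∩ I^c` of `φ(D)`, where `I` is the minimal ideal belonging to `g`. -/
def constituent (D : Submodule F (Fin c × Fin m → F)) (g : F[X]) :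
    Submodule F (Fin c → CycRing F m) :=
  D.map phi ⊓ vectorsIn (minIdeal m g)

/-- The image of a code over `R_m` under conjugation of all coordinates. -/
def conjCode (D : Submodule F (Fin c → CycRing F m)) : Submodule F (Fin c → CycRing F m) :=
  D.map ((conj F m).toLinearMap.compLeft (Fin c))

/-- The Euclidean dual in `I^c` of a code `D ⊆ I^c`. -/
def euclideanDualIn (I : Ideal (CycRing F m)) (D : Submodule F (Fin c → CycRing F m)) :
    Submodule F (Fin c → CycRing F m) where
  carrier := {u | u ∈ vectorsIn I ∧ ∀ v ∈ D, ∑ k, u k * v k = 0}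
  zero_mem' := ⟨Submodule.zero_mem _, fun v _ => by simp⟩
  add_mem' := by
    rintro a b ⟨ha, ha'⟩ ⟨hb, hb'⟩
    refine ⟨Submodule.add_mem _ ha hb, fun v hv => ?_⟩
    simp only [Pi.add_apply, add_mul]
    rw [Finset.sum_add_distrib, ha' v hv, hb' v hv, add_zero]
  smul_mem' := by
    rintro r a ⟨ha, ha'⟩
    refine ⟨Submodule.smul_mem _ r ha, fun v hv => ?_⟩
    simp only [Pi.smul_apply, smul_mul_assoc]
    rw [← Finset.smul_sum, ha' v hv, smul_zero]

/-- The dual in `I^c` of a code `D ⊆ I^c`, with respect to the Hermitian inner product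
`(u, v) = ∑_k u_k conj(v_k)`. -/
def hermitianDualIn (I : Ideal (CycRing F m)) (D : Submodule F (Fin c → CycRing F m)) :
    Submodule F (Fin c → CycRing F m) where
  carrier := {u | u ∈ vectorsIn I ∧ ∀ v ∈ D, ∑ k, u k * conj F m (v k) = 0}
  zero_mem' := ⟨Submodule.zero_mem _, fun v _ => by simp⟩
  add_mem' := by
    rintro a b ⟨ha, ha'⟩ ⟨hb, hb'⟩
    refine ⟨Submodule.add_mem _ ha hb, fun v hv => ?_⟩
    simp only [Pi.add_apply, add_mul]
    rw [Finset.sum_add_distrib, ha' v hv, hb' v hv, add_zero]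
  smul_mem' := by
    rintro r a ⟨ha, ha'⟩
    refine ⟨Submodule.smul_mem _ r ha, fun v hv => ?_⟩
    simp only [Pi.smul_apply, smul_mul_assoc]
    rw [← Finset.smul_sum, ha' v hv, smul_zero]

/-- A code `D ⊆ I^c` over the minimal ideal `I` is Hermitian LCD. -/
def IsHermitianLCDIn (I : Ideal (CycRing F m)) (D : Submodule F (Fin c → CycRing F m)) : Prop :=
  D ⊓ hermitianDualIn I D = ⊥

variable (F m) in
/-- A factorization `x^m - 1 = δ (x - 1) g_1 ⋯ g_r h_1 h_1^* ⋯ h_t h_t^*` into irreducible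
factors, where `g_1, …, g_r` are associated with their reciprocal polynomials and `h_j^*` is the
reciprocal polynomial of `h_j`. -/
structure ReciprocalFactorization (r t : ℕ) where
  δ : F
  g : Fin r → F[X]
  h : Fin t → F[X]
  δ_ne_zero : δ ≠ 0
  irreducible_g : ∀ i, Irreducible (g i)
  associated_g : ∀ i, Associated (g i) (g i).reverse
  irreducible_h : ∀ j, Irreducible (h j)
  irreducible_h_reverse : ∀ j, Irreducible (h j).reverse
  factorization : (X ^ m - 1 : F[X]) =
    Polynomial.C δ * (X - 1) * (∏ i, g i) * ∏ j, (h j * (h j).reverse)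

/-- The conditions on the constituents of a quasi-cyclic code `D` of index `c`, other than the one
belonging to `x - 1`: each `C_i` is Hermitian LCD over `G_i`, and `C_j'' ∩ (C_j')^⊥ = {0}` and
`C_j' ∩ (C_j'')^⊥ = {0}` for the Euclidean inner product. Here `C_j'` is a code over `H_j'`
(belonging to `h_j`) and `C_j''` a code over `H_j''` (belonging to `h_j^*`); the two fields are
identified by the conjugation `x ↦ x^{-1}`, which exchanges them. -/
def ConstituentsLCD {r t : ℕ} (fac : ReciprocalFactorization F m r t)
    (D : Submodule F (Fin c × Fin m → F)) : Prop :=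
  (∀ i, IsHermitianLCDIn (minIdeal m (fac.g i)) (constituent D (fac.g i))) ∧
  (∀ j, constituent D (fac.h j).reverse ⊓
    euclideanDualIn (minIdeal m (fac.h j).reverse) (conjCode (constituent D (fac.h j))) = ⊥) ∧
  (∀ j, constituent D (fac.h j) ⊓
    euclideanDualIn (minIdeal m (fac.h j)) (conjCode (constituent D (fac.h j).reverse)) = ⊥)

end Constituents

end AQC

end

/-! Since `m` is invertible in `F`, averaging a codeword over the rotations splits `C` as `F_σ(C) ⊕
E_σ(C)`. The summands are orthogonal: a fixed vector is constant on each cycle, where a vector of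
`E_σ(C)` sums to zero. So `C` is LCD exactly when both summands are
(`isEuclideanLCD_iff_fixedSubcode_zeroSumSubcode`).

For the second summand, the coefficients of the Hermitian product on `R_m^c` are the Euclidean
products with all cyclic shifts (`herm_phi`). For a shift-invariant code, Euclidean orthogonality is
therefore Hermitian orthogonality of its image under `phi`, an `R_m`-submodule. As `x^m - 1` is
separable, `R_m` is the sum of the ideals of its factors, and distinct ideals annihilate each other.
Conjugation fixes the ideals of `x - 1` and `g_i` and exchanges those of `h_j` and `h_j^*`, so each
component pairs only with its conjugate partner (`forall_herm_iff_components`). The component at `x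
- 1` vanishes because the blocks sum to zero; the others give (i) and (ii).

For (b), on fixed vectors the Euclidean product is `m` times that of the projections. -/

noncomputable section

namespace AQC

/-! ### The permutation and its cycles -/

section Perm

variable {F : Type*} [Field F] {m c f : ℕ}

@[simp]
theorem perm_inr (i : Fin f) : perm m c f (Sum.inr i) = Sum.inr i := rfl

variable [NeZero m]

@[simp]
theorem perm_inl (k : Fin c) (i : Fin m) :
    perm m c f (Sum.inl (k, i)) = Sum.inl (k, i + 1) := by
  obtain ⟨n, rfl⟩ := Nat.exists_eq_succ_of_ne_zero (NeZero.ne m)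
  simp only [perm, Equiv.sumCongr_apply, Sum.map_inl, Equiv.prodCongr_apply, Prod.map_apply,
    Equiv.refl_apply]
  exact congrArg (fun a => Sum.inl (k, a)) (finRotate_apply i)

omit [NeZero m] in
theorem perm_pow_inr (n : ℕ) (i : Fin f) : (perm m c f ^ n) (Sum.inr i) = Sum.inr i := by
  induction n with
  | zero => rfl
  | succ n ih => rw [pow_succ', Equiv.Perm.mul_apply, ih, perm_inr]

/-- One exponent serves all blocks and positions, so `rotate j` is composition with a single power
of the permutation and preserves `C`. -/
theorem exists_perm_pow_inl (j : Fin m) :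
    ∃ n : ℕ, ∀ (k : Fin c) (i : Fin m),
      (perm m c f ^ n) (Sum.inl (k, i)) = Sum.inl (k, i + j) := by
  obtain ⟨l, rfl⟩ := Nat.exists_eq_succ_of_ne_zero (NeZero.ne m)
  induction j using Fin.induction with
  | zero => exact ⟨0, fun k i => by simp⟩
  | succ j ih =>
    obtain ⟨n, hn⟩ := ih
    refine ⟨n + 1, fun k i => ?_⟩
    rw [pow_succ', Equiv.Perm.mul_apply, hn, perm_inl, add_assoc, Fin.coeSucc_eq_succ]

theorem sameCycle_perm_inl (k : Fin c) (i : Fin m) (y : Coord m c f) :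
    (perm m c f).SameCycle (Sum.inl (k, i)) y ↔ ∃ j, y = Sum.inl (k, j) := by
  constructor
  · intro h
    obtain ⟨n, hn⟩ := h.exists_nat_pow_eq
    rw [← hn]
    clear hn h
    induction n with
    | zero => exact ⟨i, rfl⟩
    | succ n ih =>
      obtain ⟨j, hj⟩ := ih
      exact ⟨j + 1, by rw [pow_succ', Equiv.Perm.mul_apply, hj, perm_inl]⟩
  · rintro ⟨j, rfl⟩
    obtain ⟨n, hn⟩ := exists_perm_pow_inl (c := c) (f := f) (j - i)
    exact ⟨n, by rw [zpow_natCast, hn, add_sub_cancel]⟩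

omit [NeZero m] in
theorem sameCycle_perm_inr (i : Fin f) (y : Coord m c f) :
    (perm m c f).SameCycle (Sum.inr i) y ↔ y = Sum.inr i := by
  constructor
  · intro h
    obtain ⟨n, hn⟩ := h.exists_nat_pow_eq
    rw [← hn, perm_pow_inr]
  · rintro rfl
    exact Equiv.Perm.SameCycle.refl _ _

/-- Rotation of all blocks by `j` positions. -/
def rotate (j : Fin m) (v : Coord m c f → F) : Coord m c f → F :=
  Sum.elim (fun x => v (Sum.inl (x.1, x.2 + j))) (fun i => v (Sum.inr i))

theorem IsPermAut.rotate_mem {C : Submodule F (Coord m c f → F)}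
    (hC : IsPermAut (perm m c f) C) (j : Fin m) {v : Coord m c f → F} (hv : v ∈ C) :
    rotate j v ∈ C := by
  have hpow : ∀ n : ℕ, v ∘ (perm m c f ^ n : Equiv.Perm _) ∈ C := by
    intro n
    induction n with
    | zero => simpa using hv
    | succ n ih =>
      rw [pow_succ, Equiv.Perm.coe_mul, ← Function.comp_assoc]
      exact (hC _).1 ih
  obtain ⟨n, hn⟩ := exists_perm_pow_inl (c := c) (f := f) j
  convert hpow n using 1
  funext x
  rcases x with ⟨k, i⟩ | i
  · simp [rotate, hn]
  · simp [rotate, perm_pow_inr]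

theorem mem_zeroSumSubcode_perm {C : Submodule F (Coord m c f → F)} {v : Coord m c f → F} :
    v ∈ zeroSumSubcode (perm m c f) C ↔
      v ∈ C ∧ (∀ k, ∑ i, v (Sum.inl (k, i)) = 0) ∧ ∀ i, v (Sum.inr i) = 0 := by
  classical
  refine and_congr_right fun _ => ?_
  have hl : ∀ k i, ∑ j with (perm m c f).SameCycle (Sum.inl (k, i)) j, v j =
      ∑ j, v (Sum.inl (k, j)) := by
    intro k i
    refine Eq.trans (Finset.sum_congr (Finset.ext fun y => ?_) fun _ _ => rfl)
      (Finset.sum_map Finset.univ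
        ⟨fun j => (Sum.inl (k, j) : Coord m c f), fun a b h => by simpa using h⟩ v)
    rw [Finset.mem_filter, sameCycle_perm_inl, Finset.mem_map]
    simp only [Finset.mem_univ, true_and]
    exact exists_congr fun j => eq_comm
  have hr : ∀ i, ∑ j with (perm m c f).SameCycle (Sum.inr i) j, v j = v (Sum.inr i) := by
    intro i
    simp [sameCycle_perm_inr, Finset.filter_eq']
  constructor
  · intro h
    exact ⟨fun k => by rw [← hl k 0]; convert h (Sum.inl (k, 0)),
      fun i => by rw [← hr i]; convert h (Sum.inr i)⟩
  · rintro ⟨h₁, h₂⟩ (⟨k, i⟩ | i)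
    · convert (hl k i).trans (h₁ k)
    · convert (hr i).trans (h₂ i)

omit [Field F] in
theorem comp_perm_eq_iff {v : Coord m c f → F} :
    v ∘ perm m c f = v ↔ ∀ k i, v (Sum.inl (k, i)) = v (Sum.inl (k, 0)) := by
  constructor
  · intro h k i
    obtain ⟨n, hn⟩ := exists_perm_pow_inl (c := c) (f := f) i
    have hpow : ∀ n : ℕ, v ∘ (perm m c f ^ n : Equiv.Perm _) = v := by
      intro n
      induction n with
      | zero => rfl
      | succ n ih => rw [pow_succ, Equiv.Perm.coe_mul, ← Function.comp_assoc, ih, h]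
    have := congrFun (hpow n) (Sum.inl (k, 0))
    rwa [Function.comp_apply, hn, zero_add] at this
  · intro h
    funext x
    rcases x with ⟨k, i⟩ | i
    · rw [Function.comp_apply, perm_inl, h, ← h k i]
    · rfl

end Perm

/-! ### Reduction to the fixed and the zero-sum subcode -/

section Reduction

variable {F : Type*} [Field F]

theorem isEuclideanLCD_iff {ι : Type*} [Fintype ι] {C : Submodule F (ι → F)} :
    IsEuclideanLCD C ↔ ∀ u ∈ C, (∀ v ∈ C, u ⬝ᵥ v = 0) → u = 0 := by
  rw [IsEuclideanLCD, Submodule.eq_bot_iff]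
  exact ⟨fun h u hu hv => h u ⟨hu, hv⟩, fun h u hu => h u hu.1 hu.2⟩

/-- An orthogonal sum of two codes is Euclidean LCD if and only if both of them are. -/
theorem isEuclideanLCD_iff_of_orthogonal {ι : Type*} [Fintype ι] {A B C : Submodule F (ι → F)}
    (hA : A ≤ C) (hB : B ≤ C) (hAB : ∀ a ∈ A, ∀ b ∈ B, a ⬝ᵥ b = 0)
    (hC : ∀ v ∈ C, ∃ a ∈ A, ∃ b ∈ B, a + b = v) :
    IsEuclideanLCD C ↔ IsEuclideanLCD A ∧ IsEuclideanLCD B := by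
  simp only [isEuclideanLCD_iff]
  constructor
  · refine fun h => ⟨fun u hu hv => h u (hA hu) fun w hw => ?_,
      fun u hu hv => h u (hB hu) fun w hw => ?_⟩
    · obtain ⟨a, ha, b, hb, rfl⟩ := hC w hw
      rw [dotProduct_add, hv a ha, hAB u hu b hb, add_zero]
    · obtain ⟨a, ha, b, hb, rfl⟩ := hC w hw
      rw [dotProduct_add, hv b hb, dotProduct_comm, hAB a ha u hu, add_zero]
  · rintro ⟨h₁, h₂⟩ u hu hv
    obtain ⟨a, ha, b, hb, rfl⟩ := hC u hu
    rw [h₁ a ha, h₂ b hb, add_zero]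
    · intro w hw
      rw [← hv w (hB hw), add_dotProduct, hAB a ha w hw, zero_add]
    · intro w hw
      rw [← hv w (hA hw), add_dotProduct, dotProduct_comm b, hAB w hw b hb, add_zero]

variable {m c f : ℕ} [NeZero m]

omit [NeZero m] in
theorem dotProduct_coord (u v : Coord m c f → F) :
    u ⬝ᵥ v = ∑ k, ∑ i, u (Sum.inl (k, i)) * v (Sum.inl (k, i)) +
      ∑ i, u (Sum.inr i) * v (Sum.inr i) := by
  rw [dotProduct, Fintype.sum_sum_type, Fintype.sum_prod_type]

theorem isEuclideanLCD_iff_fixedSubcode_zeroSumSubcode (hm : (m : F) ≠ 0)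
    {C : Submodule F (Coord m c f → F)} (hC : IsPermAut (perm m c f) C) :
    IsEuclideanLCD C ↔ IsEuclideanLCD (fixedSubcode (perm m c f) C) ∧
      IsEuclideanLCD (zeroSumSubcode (perm m c f) C) := by
  refine isEuclideanLCD_iff_of_orthogonal (fun _ h => h.1) (fun _ h => h.1) ?_ ?_
  · rintro a ⟨-, ha⟩ b hb
    rw [comp_perm_eq_iff] at ha
    obtain ⟨-, hb₁, hb₂⟩ := mem_zeroSumSubcode_perm.1 hb
    rw [dotProduct_coord]
    simp only [ha _, ← Finset.mul_sum, hb₁, hb₂, mul_zero, Finset.sum_const_zero, add_zero]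
  · intro v hv
    -- The average over the rotations replaces each block by its mean and keeps the fixed
    -- coordinates.
    set w : Coord m c f → F := (m : F)⁻¹ • ∑ j : Fin m, rotate j v with hw
    have hwC : w ∈ C := C.smul_mem _ (C.sum_mem fun j _ => hC.rotate_mem j hv)
    have hwl : ∀ k i, w (Sum.inl (k, i)) = (m : F)⁻¹ * ∑ j, v (Sum.inl (k, j)) := by
      intro k i
      rw [hw, Pi.smul_apply, Finset.sum_apply, smul_eq_mul]
      congr 1
      exact Fintype.sum_equiv (Equiv.addLeft i) _ _ fun j => rfl
    have hwr : ∀ i, w (Sum.inr i) = v (Sum.inr i) := by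
      intro i
      rw [hw, Pi.smul_apply, Finset.sum_apply, smul_eq_mul]
      simp [rotate, hm]
    refine ⟨w, ⟨hwC, comp_perm_eq_iff.2 fun k i => by rw [hwl, hwl]⟩, v - w,
      mem_zeroSumSubcode_perm.2 ⟨C.sub_mem hv hwC, fun k => ?_, fun i => ?_⟩,
      add_sub_cancel _ _⟩
    · simp [hwl, hm]
    · rw [Pi.sub_apply, hwr, sub_self]

theorem mem_zeroSumPunctured {C : Submodule F (Coord m c f → F)} {d : Fin c × Fin m → F} :
    d ∈ zeroSumPunctured C ↔ Sum.elim d 0 ∈ C ∧ ∀ k, ∑ i, d (k, i) = 0 := by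
  rw [zeroSumPunctured, Submodule.mem_map]
  constructor
  · rintro ⟨v, hv, rfl⟩
    obtain ⟨hv, h₁, h₂⟩ := mem_zeroSumSubcode_perm.1 hv
    refine ⟨?_, h₁⟩
    convert hv using 1
    funext x
    rcases x with x | i
    · rfl
    · exact (h₂ i).symm
  · rintro ⟨hd, h⟩
    exact ⟨_, mem_zeroSumSubcode_perm.2 ⟨hd, h, fun _ => rfl⟩, rfl⟩

theorem isEuclideanLCD_zeroSumSubcode_iff {C : Submodule F (Coord m c f → F)} :
    IsEuclideanLCD (zeroSumSubcode (perm m c f) C) ↔ IsEuclideanLCD (zeroSumPunctured C) := by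
  have hdot : ∀ u v : Coord m c f → F, v ∈ zeroSumSubcode (perm m c f) C →
      (u ∘ Sum.inl) ⬝ᵥ (v ∘ Sum.inl) = u ⬝ᵥ v := by
    intro u v hv
    obtain ⟨-, -, h⟩ := mem_zeroSumSubcode_perm.1 hv
    simp [dotProduct, h]
  simp only [isEuclideanLCD_iff]
  constructor
  · rintro h _ ⟨u, hu, rfl⟩ hv
    rw [h u hu fun v hvC => ?_, map_zero]
    rw [← hdot u v hvC]
    exact hv _ ⟨v, hvC, rfl⟩
  · intro h u hu hv
    have := h _ ⟨u, hu, rfl⟩ (by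
      rintro _ ⟨v, hvC, rfl⟩
      exact (hdot u v hvC).trans (hv v hvC))
    funext x
    rcases x with x | i
    · exact congrFun this x
    · exact (mem_zeroSumSubcode_perm.1 hu).2.2 i

/-- A block contributes its projected term `m` times, a fixed point only once. The congruence
condition makes the two weights agree in `F`, so the forms differ by the nonzero scalar `m`. -/
theorem isEuclideanLCD_projCode_iff (p : ℕ) [CharP F p] (hm : (m : F) ≠ 0)
    (h : f = 0 ∨ m ≡ 1 [MOD p]) {C : Submodule F (Coord m c f → F)} :
    IsEuclideanLCD (projCode C) ↔ IsEuclideanLCD (fixedSubcode (perm m c f) C) := by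
  have hdot : ∀ u ∈ fixedSubcode (perm m c f) C, ∀ v ∈ fixedSubcode (perm m c f) C,
      u ⬝ᵥ v = (m : F) * (proj u ⬝ᵥ proj v) := by
    rintro u ⟨-, hu⟩ v ⟨-, hv⟩
    rw [comp_perm_eq_iff] at hu hv
    rw [dotProduct_coord, dotProduct, Fintype.sum_sum_type, mul_add]
    simp only [hu _, hv _, Finset.sum_const, Finset.card_univ, Fintype.card_fin, nsmul_eq_mul]
    rw [← Finset.mul_sum]
    congr 1
    rcases h with rfl | h
    · simp
    · have h1 : (m : F) = 1 := by simpa using (CharP.natCast_eq_natCast F p).2 h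
      rw [h1, one_mul]
      rfl
  simp only [isEuclideanLCD_iff]
  constructor
  · intro h u hu hv
    have := h _ ⟨u, hu, rfl⟩ (by
      rintro _ ⟨v, hvC, rfl⟩
      have := hdot u hu v hvC
      rw [hv v hvC, eq_comm, mul_eq_zero] at this
      exact this.resolve_left hm)
    funext x
    rcases x with ⟨k, i⟩ | i
    · rw [comp_perm_eq_iff.1 hu.2]
      exact congrFun this (Sum.inl k)
    · exact congrFun this (Sum.inr i)
  · rintro h _ ⟨u, hu, rfl⟩ hv
    rw [h u hu fun v hvC => ?_, map_zero]
    rw [hdot u hu v hvC, hv _ ⟨v, hvC, rfl⟩, mul_zero]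

theorem IsPermAut.rotate_zeroSumPunctured {C : Submodule F (Coord m c f → F)}
    (hC : IsPermAut (perm m c f) C) (j : Fin m) {d : Fin c × Fin m → F}
    (hd : d ∈ zeroSumPunctured C) : (fun x => d (x.1, x.2 + j)) ∈ zeroSumPunctured C := by
  rw [mem_zeroSumPunctured] at hd ⊢
  refine ⟨hC.rotate_mem j hd.1, fun k => ?_⟩
  rw [← hd.2 k]
  exact Fintype.sum_equiv (Equiv.addRight j) _ _ fun i => rfl

end Reduction

/-! ### The ring `F[x]/(x^m - 1)` -/

section CycRing

variable {F : Type*} [Field F] {m : ℕ}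

/-- Describing the ideal as the annihilator of `q` turns later membership proofs into ring
computations. -/
theorem mem_minIdeal_iff {q : F[X]} [NeZero m] (hq : q ∣ X ^ m - 1) {a : CycRing F m} :
    a ∈ minIdeal m q ↔ AdjoinRoot.mk (X ^ m - 1 : F[X]) q * a = 0 := by
  have hne : (X ^ m - 1 : F[X]) ≠ 0 := X_pow_sub_C_ne_zero (NeZero.pos m) 1
  have hq0 : q ≠ 0 := ne_zero_of_dvd_ne_zero hne hq
  have hmul : q * ((X ^ m - 1) / q) = X ^ m - 1 := EuclideanDomain.mul_div_cancel' hq0 hq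
  rw [minIdeal, Ideal.mem_span_singleton]
  constructor
  · rintro ⟨b, rfl⟩
    rw [← mul_assoc, ← map_mul, hmul, AdjoinRoot.mk_self, zero_mul]
  · obtain ⟨A, rfl⟩ := AdjoinRoot.mk_surjective a
    intro h
    rw [← map_mul, AdjoinRoot.mk_eq_zero] at h
    nth_rw 1 [← hmul] at h
    exact map_dvd _ ((mul_dvd_mul_iff_left hq0).1 h)

variable (F m) in
theorem conj_xbar : conj F m (xbar F m) = xbar F m ^ (m - 1) :=
  AdjoinRoot.liftAlgHom_root _ _ _ _

variable [NeZero m]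

variable (F m) in
theorem xbar_mul_conj : xbar F m * conj F m (xbar F m) = 1 := by
  rw [conj_xbar, ← pow_succ', Nat.sub_add_cancel (NeZero.one_le), xbar_pow]

omit [NeZero m] in
theorem conj_mk (q : F[X]) :
    conj F m (AdjoinRoot.mk _ q) = eval₂ (algebraMap F _) (conj F m (xbar F m)) q := by
  rw [← AdjoinRoot.aeval_eq, ← aeval_def, ← Polynomial.aeval_algHom_apply]
  rfl

omit [NeZero m] in
theorem mk_eq_eval₂ (q : F[X]) :
    AdjoinRoot.mk (X ^ m - 1 : F[X]) q = eval₂ (algebraMap F _) (xbar F m) q := by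
  rw [← AdjoinRoot.aeval_eq, ← aeval_def]
  rfl

theorem conj_mk_reverse_mul (q : F[X]) :
    conj F m (AdjoinRoot.mk _ q.reverse) * xbar F m ^ q.natDegree = AdjoinRoot.mk _ q := by
  -- With this instance the inverse of `x` is its conjugate by definition, as the closing `exact`
  -- requires.
  let i : Invertible (xbar F m) := invertibleOfLeftInverse _ (conj F m (xbar F m))
    (by rw [mul_comm, xbar_mul_conj])
  rw [conj_mk, mk_eq_eval₂]
  exact eval₂_reverse_mul_pow (algebraMap F _) (xbar F m) q

theorem mk_reverse_mul (q : F[X]) :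
    AdjoinRoot.mk _ q.reverse * conj F m (xbar F m) ^ q.natDegree =
      conj F m (AdjoinRoot.mk _ q) := by
  let i : Invertible (conj F m (xbar F m)) := invertibleOfLeftInverse _ (xbar F m)
    (xbar_mul_conj F m)
  rw [conj_mk, mk_eq_eval₂]
  exact eval₂_reverse_mul_pow (algebraMap F _) (conj F m (xbar F m)) q

theorem conj_mem_minIdeal_of_reverse {q : F[X]} (hq : q ∣ X ^ m - 1)
    (hq' : q.reverse ∣ X ^ m - 1) {a : CycRing F m} (ha : a ∈ minIdeal m q.reverse) :
    conj F m a ∈ minIdeal m q := by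
  rw [mem_minIdeal_iff hq'] at ha
  rw [mem_minIdeal_iff hq, ← conj_mk_reverse_mul, mul_right_comm, ← map_mul, ha, map_zero,
    zero_mul]

/-- Proved separately from the opposite direction, since `reverse` is not an involution on all
polynomials. -/
theorem conj_mem_minIdeal_reverse {q : F[X]} (hq : q ∣ X ^ m - 1)
    (hq' : q.reverse ∣ X ^ m - 1) {a : CycRing F m} (ha : a ∈ minIdeal m q) :
    conj F m a ∈ minIdeal m q.reverse := by
  rw [mem_minIdeal_iff hq] at ha
  rw [mem_minIdeal_iff hq']
  have hu : xbar F m ^ q.natDegree * conj F m (xbar F m) ^ q.natDegree = 1 := by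
    rw [← mul_pow, xbar_mul_conj, one_pow]
  calc _ = xbar F m ^ q.natDegree * conj F m (xbar F m) ^ q.natDegree *
        (AdjoinRoot.mk _ q.reverse * conj F m a) := by rw [hu, one_mul]
    _ = xbar F m ^ q.natDegree * (AdjoinRoot.mk _ q.reverse *
        conj F m (xbar F m) ^ q.natDegree * conj F m a) := by ring
    _ = 0 := by rw [mk_reverse_mul, ← map_mul, ha, map_zero, mul_zero]

theorem minIdeal_le_of_associated {q q' : F[X]} (h : Associated q q') (hq : q ∣ X ^ m - 1) :
    minIdeal m q ≤ minIdeal m q' := by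
  intro a ha
  obtain ⟨s, rfl⟩ := h.dvd
  rw [mem_minIdeal_iff hq] at ha
  rw [mem_minIdeal_iff (h.dvd_iff_dvd_left.1 hq), map_mul, mul_right_comm, ha, zero_mul]

theorem conj_mem_minIdeal_of_associated {q : F[X]} (hq : q ∣ X ^ m - 1)
    (h : Associated q q.reverse) {a : CycRing F m} (ha : a ∈ minIdeal m q) :
    conj F m a ∈ minIdeal m q := by
  have hq' := h.dvd_iff_dvd_left.1 hq
  exact minIdeal_le_of_associated h.symm hq' (conj_mem_minIdeal_reverse hq hq' ha)

theorem mem_minIdeal_X_sub_one {a : CycRing F m} :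
    a ∈ minIdeal m (X - 1) ↔ xbar F m * a = a := by
  rw [mem_minIdeal_iff (by simpa using sub_dvd_pow_sub_pow (X : F[X]) 1 m), map_sub, map_one,
    AdjoinRoot.mk_X, sub_mul, one_mul, sub_eq_zero]
  rfl

theorem conj_mem_minIdeal_X_sub_one {a : CycRing F m} (ha : a ∈ minIdeal m (X - 1)) :
    conj F m a ∈ minIdeal m (X - 1) := by
  rw [mem_minIdeal_X_sub_one] at ha ⊢
  nth_rw 1 [← ha]
  rw [map_mul, ← mul_assoc, xbar_mul_conj, one_mul]

theorem mul_eq_zero_of_mem_minIdeal {q q' : F[X]} (hq : q ∣ X ^ m - 1) (hq' : q' ∣ X ^ m - 1)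
    (h : IsCoprime q q') {a b : CycRing F m} (ha : a ∈ minIdeal m q)
    (hb : b ∈ minIdeal m q') : a * b = 0 := by
  rw [mem_minIdeal_iff hq] at ha
  rw [mem_minIdeal_iff hq'] at hb
  obtain ⟨s, t, hst⟩ := h
  calc a * b = AdjoinRoot.mk (X ^ m - 1 : F[X]) (s * q + t * q') * (a * b) := by
        rw [hst, map_one, one_mul]
    _ = AdjoinRoot.mk _ s * (AdjoinRoot.mk _ q * a) * b +
        AdjoinRoot.mk _ t * a * (AdjoinRoot.mk _ q' * b) := by
      rw [map_add, map_mul, map_mul]; ring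
    _ = 0 := by rw [ha, hb]; ring

/-- The ideals belonging to the factors of `x^m - 1` add up to the whole ring. -/
theorem exists_sum_mem_minIdeal_eq_one {κ : Type*} [Fintype κ] [Nonempty κ] {q : κ → F[X]}
    {δ : F} (hδ : δ ≠ 0) (hq : (X ^ m - 1 : F[X]) = C δ * ∏ i, q i)
    (hcop : Pairwise fun i j => IsCoprime (q i) (q j)) :
    ∃ e : κ → CycRing F m, (∀ i, e i ∈ minIdeal m (q i)) ∧ ∑ i, e i = 1 := by
  classical
  obtain ⟨μ, hμ⟩ := (exists_sum_eq_one_iff_pairwise_coprime (s := q)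
    (Finset.univ_nonempty (α := κ))).2 fun i j hij => hcop (Subtype.coe_injective.ne hij)
  -- The Bézout summand for `q i` contains all the other factors, so `q i` kills it modulo `x^m -
  -- 1`.
  refine ⟨fun i => AdjoinRoot.mk _ (μ i * ∏ j ∈ Finset.univ \ {i}, q j), fun i => ?_, ?_⟩
  · have hdvd : q i ∣ X ^ m - 1 :=
      hq ▸ Dvd.dvd.mul_left (Finset.dvd_prod_of_mem q (Finset.mem_univ i)) _
    rw [mem_minIdeal_iff hdvd, ← map_mul, mul_left_comm, AdjoinRoot.mk_eq_zero]
    refine Dvd.dvd.mul_left ?_ _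
    rw [← Finset.erase_eq, Finset.mul_prod_erase _ _ (Finset.mem_univ i), hq]
    exact ⟨C δ⁻¹, by rw [mul_right_comm, ← C_mul, mul_inv_cancel₀ hδ, C_1, one_mul]⟩
  · rw [← map_sum, hμ, map_one]

end CycRing

/-! ### Hermitian orthogonality and the decomposition into constituents -/

section Decomposition

variable {F : Type*} [Field F] {m c : ℕ}

/-- The Hermitian inner product on `R_m^c`. -/
def herm (u v : Fin c → CycRing F m) : CycRing F m := ∑ k, u k * conj F m (v k)

theorem herm_smul_left (a : CycRing F m) (u v : Fin c → CycRing F m) :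
    herm (a • u) v = a * herm u v := by
  simp [herm, Finset.mul_sum, mul_assoc]

theorem herm_sum_right {κ : Type*} (s : Finset κ) (u : Fin c → CycRing F m)
    (v : κ → Fin c → CycRing F m) : herm u (∑ i ∈ s, v i) = ∑ i ∈ s, herm u (v i) := by
  simp only [herm, Finset.sum_apply, map_sum, Finset.mul_sum]
  exact Finset.sum_comm

theorem mem_vectorsIn {I : Ideal (CycRing F m)} {v : Fin c → CycRing F m} :
    v ∈ vectorsIn I ↔ ∀ k, v k ∈ I := by
  simp [vectorsIn, Submodule.mem_pi]

/-- A submodule of `R_m^c` meets its Hermitian dual trivially if and only if all its components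
meet the Hermitian duals of their conjugate components trivially. -/
theorem forall_herm_iff_components {κ : Type*} [Fintype κ] {I : κ → Ideal (CycRing F m)}
    {τ : κ → κ} (hτ : Function.Involutive τ) {e : κ → CycRing F m} (he : ∀ i, e i ∈ I i)
    (hsum : ∑ i, e i = 1) (hmul : ∀ i j, i ≠ j → ∀ a ∈ I i, ∀ b ∈ I j, a * b = 0)
    (hconj : ∀ i, ∀ a ∈ I i, conj F m a ∈ I (τ i))
    {M : Submodule F (Fin c → CycRing F m)} (hM : ∀ a : CycRing F m, ∀ v ∈ M, a • v ∈ M) :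
    (∀ u ∈ M, (∀ v ∈ M, herm u v = 0) → u = 0) ↔
      ∀ i, ∀ u ∈ M ⊓ vectorsIn (I i), (∀ v ∈ M ⊓ vectorsIn (I (τ i)), herm u v = 0) → u = 0 := by
  have hcomp : ∀ i, ∀ v ∈ M, e i • v ∈ M ⊓ vectorsIn (I i) := fun i v hv =>
    ⟨hM _ _ hv, mem_vectorsIn.2 fun k => Ideal.mul_mem_right _ _ (he i)⟩
  have hdec : ∀ v : Fin c → CycRing F m, v = ∑ i, e i • v := fun v => by
    rw [← Finset.sum_smul, hsum, one_smul]
  constructor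
  · rintro h i u ⟨hu, huI⟩ hv
    refine h u hu fun v hvM => ?_
    rw [hdec v, herm_sum_right]
    -- The conjugate of the `j`-th component of `v` lies in `I (τ j)`, hence is killed by `I i`
    -- unless `j = τ i`.
    refine Finset.sum_eq_zero fun j _ => ?_
    by_cases hj : j = τ i
    · subst hj
      exact hv _ (hcomp _ v hvM)
    · refine Finset.sum_eq_zero fun k _ => hmul i (τ j) (fun h => hj ?_) _
        (mem_vectorsIn.1 huI k) _ (hconj j _ (mem_vectorsIn.1 (hcomp j v hvM).2 k))
      rw [h, hτ]
  · intro h u hu hv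
    rw [hdec u]
    refine Finset.sum_eq_zero fun i _ => h i _ (hcomp i u hu) fun v hvM => ?_
    rw [herm_smul_left, hv v hvM.1, mul_zero]

theorem inf_hermitianDualIn_eq_bot_iff {M : Submodule F (Fin c → CycRing F m)}
    {I : Ideal (CycRing F m)} :
    IsHermitianLCDIn I (M ⊓ vectorsIn I) ↔
      ∀ u ∈ M ⊓ vectorsIn I, (∀ v ∈ M ⊓ vectorsIn I, herm u v = 0) → u = 0 := by
  rw [IsHermitianLCDIn, Submodule.eq_bot_iff]
  exact ⟨fun h u hu hv => h u ⟨hu, hu.2, hv⟩, fun h u hu => h u hu.1 hu.2.2⟩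

/-- The Euclidean product with a conjugated vector is `herm`, so condition (ii) takes the form
produced by the decomposition. -/
theorem inf_euclideanDualIn_conjCode_eq_bot_iff {M N : Submodule F (Fin c → CycRing F m)}
    {I : Ideal (CycRing F m)} :
    (M ⊓ vectorsIn I) ⊓ euclideanDualIn I (conjCode N) = ⊥ ↔
      ∀ u ∈ M ⊓ vectorsIn I, (∀ v ∈ N, herm u v = 0) → u = 0 := by
  rw [Submodule.eq_bot_iff]
  constructor
  · refine fun h u hu hv => h u ⟨hu, hu.2, ?_⟩
    rintro _ ⟨v, hvN, rfl⟩
    exact hv v hvN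
  · exact fun h u hu => h u hu.1 fun v hv => hu.2.2 _ ⟨v, hv, rfl⟩

end Decomposition

/-! ### The map `φ` and cyclic shifts -/

section Phi

variable {F : Type*} [Field F] {m c : ℕ} [NeZero m]

variable (F) in
theorem linearIndependent_xbar_pow :
    LinearIndependent F fun i : Fin m => xbar F m ^ (i : ℕ) := by
  have hmonic : (X ^ m - 1 : F[X]).Monic := monic_X_pow_sub_C 1 (NeZero.ne m)
  have hdim : (AdjoinRoot.powerBasis' hmonic).dim = m := by
    rw [AdjoinRoot.powerBasis'_dim]
    exact natDegree_X_pow_sub_C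
  have h := (AdjoinRoot.powerBasis' hmonic).basis.linearIndependent.comp (Fin.cast hdim.symm)
    (Fin.cast_injective _)
  have heq : (fun i : Fin m => xbar F m ^ (i : ℕ)) =
      (AdjoinRoot.powerBasis' hmonic).basis ∘ Fin.cast hdim.symm := by
    funext i
    simp [xbar]
  exact heq ▸ h

omit [NeZero m] in
variable (F) in
theorem xbar_pow_val_add (i j : Fin m) :
    xbar F m ^ ((i + j : Fin m) : ℕ) = xbar F m ^ (i : ℕ) * xbar F m ^ (j : ℕ) := by
  rw [Fin.val_add, ← pow_add]
  conv_rhs => rw [← Nat.mod_add_div (i + j : ℕ) m, pow_add, pow_mul, xbar_pow, one_pow, mul_one]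

variable (F) in
theorem xbar_pow_val_sub (i j : Fin m) :
    xbar F m ^ ((i - j : Fin m) : ℕ) =
      xbar F m ^ (i : ℕ) * conj F m (xbar F m ^ (j : ℕ)) := by
  have h := xbar_pow_val_add F (i - j) j
  rw [sub_add_cancel] at h
  rw [h, map_pow, mul_assoc, ← mul_pow, xbar_mul_conj, one_pow, mul_one]

/-- The coefficients of the Hermitian inner product are Euclidean inner products with the cyclic
shifts. -/
theorem herm_phi (u d : Fin c × Fin m → F) :
    herm (phi u) (phi d) =
      ∑ l : Fin m, (u ⬝ᵥ fun x => d (x.1, x.2 + -l)) • xbar F m ^ (l : ℕ) := by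
  have h : ∀ k, phi u k * conj F m (phi d k) =
      ∑ l : Fin m, ∑ i, (u (k, i) * d (k, i + -l)) • xbar F m ^ (l : ℕ) := by
    intro k
    simp only [phi, LinearMap.coe_mk, AddHom.coe_mk, map_sum, map_smul, Finset.sum_mul_sum]
    rw [Finset.sum_comm (s := (Finset.univ : Finset (Fin m))) (t := Finset.univ)]
    rw [Finset.sum_comm]
    conv_rhs => rw [Finset.sum_comm]
    -- Substitute `l = i - j`, because `x^i` times the conjugate of `x^j` is `x^(i-j)`.
    refine Finset.sum_congr rfl fun i _ => Fintype.sum_equiv (Equiv.subLeft i) _ _ fun j => ?_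
    rw [smul_mul_smul_comm, Equiv.subLeft_apply, xbar_pow_val_sub]
    congr 3
    abel_nf
  simp only [herm, h]
  rw [Finset.sum_comm]
  refine Finset.sum_congr rfl fun l _ => ?_
  rw [dotProduct, Fintype.sum_prod_type, Finset.sum_smul]
  simp only [Finset.sum_smul]

theorem phi_injective : Function.Injective (phi : (Fin c × Fin m → F) →ₗ[F] _) := by
  rw [← LinearMap.ker_eq_bot, LinearMap.ker_eq_bot']
  intro v hv
  funext x
  exact Fintype.linearIndependent_iff.1 (linearIndependent_xbar_pow F) _ (congrFun hv x.1) x.2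

variable {D : Submodule F (Fin c × Fin m → F)}
  (hD : ∀ j : Fin m, ∀ d ∈ D, (fun x => d (x.1, x.2 + j)) ∈ D)
include hD

theorem isEuclideanLCD_iff_herm :
    IsEuclideanLCD D ↔ ∀ u ∈ D.map phi, (∀ v ∈ D.map phi, herm u v = 0) → u = 0 := by
  have horth : ∀ u, (∀ d ∈ D, u ⬝ᵥ d = 0) ↔ ∀ d ∈ D, herm (phi u) (phi d) = 0 := by
    refine fun u => ⟨fun h d hd => ?_, fun h d hd => ?_⟩
    · rw [herm_phi]
      exact Finset.sum_eq_zero fun l _ => by rw [h _ (hD _ d hd), zero_smul]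
    · have := h d hd
      rw [herm_phi] at this
      -- The coefficient at `l = 0` is the unshifted Euclidean product.
      simpa using Fintype.linearIndependent_iff.1 (linearIndependent_xbar_pow F) _ this 0
  rw [isEuclideanLCD_iff]
  constructor
  · rintro h _ ⟨u, hu, rfl⟩ hv
    rw [h u hu ((horth u).2 fun d hd => hv _ ⟨d, hd, rfl⟩), map_zero]
  · intro h u hu hv
    refine phi_injective (c := c) ((h _ ⟨u, hu, rfl⟩ ?_).trans (map_zero _).symm)
    rintro _ ⟨d, hd, rfl⟩
    exact (horth u).1 hv d hd

theorem smul_mem_map_phi (a : CycRing F m) {v : Fin c → CycRing F m} (hv : v ∈ D.map phi) :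
    a • v ∈ D.map phi := by
  have hx : ∀ v ∈ D.map phi, xbar F m • v ∈ D.map phi := by
    rintro _ ⟨d, hd, rfl⟩
    refine ⟨_, hD (-1) d hd, ?_⟩
    -- When `m = 1` the element `1 : Fin m` has value `0`; the identity then rests on `x^m = 1`.
    have h1 : xbar F m ^ ((1 : Fin m) : ℕ) = xbar F m := by
      have hval : ((1 : Fin m) : ℕ) = 1 % m := rfl
      rw [hval]
      conv_rhs => rw [← pow_one (xbar F m), ← Nat.mod_add_div 1 m, pow_add, pow_mul, xbar_pow,
        one_pow, mul_one]
    funext k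
    simp only [phi, LinearMap.coe_mk, AddHom.coe_mk, Pi.smul_apply, smul_eq_mul, Finset.mul_sum]
    refine (Fintype.sum_equiv (Equiv.addRight (1 : Fin m)) _ _ fun i => ?_).symm
    rw [Equiv.coe_addRight, add_neg_cancel_right, xbar_pow_val_add, h1, mul_smul_comm, mul_comm]
  obtain ⟨A, rfl⟩ := AdjoinRoot.mk_surjective a
  induction A using Polynomial.induction_on' with
  | add A B hA hB => rw [map_add, add_smul]; exact Submodule.add_mem _ hA hB
  | monomial n b =>
    rw [← C_mul_X_pow_eq_monomial, map_mul, map_pow, mul_smul, AdjoinRoot.mk_C]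
    have hpow : ∀ n : ℕ, xbar F m ^ n • v ∈ D.map phi := by
      intro n
      induction n with
      | zero => simpa using hv
      | succ n ih => rw [pow_succ', mul_smul]; exact hx _ ih
    have := Submodule.smul_mem _ b (hpow n)
    rwa [← algebraMap_smul (CycRing F m) b] at this

-- Let `s = ∑ x^j`. If `x` fixes an entry, `s` multiplies it by `m`. On the other hand `s * x^i =
-- s`, so `s` times the entry is its block sum times `s`, which is zero.
omit hD in
theorem eq_zero_of_mem_minIdeal_X_sub_one (hm : (m : F) ≠ 0)
    (h0 : ∀ d ∈ D, ∀ k, ∑ i, d (k, i) = 0) {v : Fin c → CycRing F m}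
    (hv : v ∈ D.map phi ⊓ vectorsIn (minIdeal m (X - 1))) : v = 0 := by
  obtain ⟨⟨d, hd, rfl⟩, hI⟩ := hv
  funext k
  have hk := mem_minIdeal_X_sub_one.1 (mem_vectorsIn.1 hI k)
  have hpow : ∀ n : ℕ, xbar F m ^ n * phi d k = phi d k := by
    intro n
    induction n with
    | zero => rw [pow_zero, one_mul]
    | succ n ih => rw [pow_succ, mul_assoc, hk, ih]
  have hs : (∑ j : Fin m, xbar F m ^ (j : ℕ)) * phi d k = 0 := by
    have hi : ∀ i : Fin m, (∑ j : Fin m, xbar F m ^ (j : ℕ)) * xbar F m ^ (i : ℕ) =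
        ∑ j : Fin m, xbar F m ^ (j : ℕ) := fun i => by
      rw [Finset.sum_mul]
      exact Fintype.sum_equiv (Equiv.addRight i) _ _ fun j => (xbar_pow_val_add F j i).symm
    simp only [phi, LinearMap.coe_mk, AddHom.coe_mk]
    rw [Finset.mul_sum]
    simp only [mul_smul_comm, hi]
    rw [← Finset.sum_smul, h0 d hd k, zero_smul]
  rw [Finset.sum_mul] at hs
  simp only [hpow, Finset.sum_const, Finset.card_univ, Fintype.card_fin] at hs
  rw [← Nat.cast_smul_eq_nsmul F] at hs
  exact (smul_eq_zero.1 hs).resolve_left hm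

end Phi

/-! ### Quasi-cyclic codes -/

section QuasiCyclic

variable {F : Type*} [Field F] {m c r t : ℕ} [NeZero m]

namespace ReciprocalFactorization

variable (fac : ReciprocalFactorization F m r t)

/-- The family of all irreducible factors. -/
def factor : Unit ⊕ (Fin r ⊕ (Fin t ⊕ Fin t)) → F[X] :=
  Sum.elim (fun _ => X - 1) (Sum.elim fac.g (Sum.elim fac.h fun j => (fac.h j).reverse))

omit [NeZero m] in
theorem eq_C_mul_prod_factor : (X ^ m - 1 : F[X]) = Polynomial.C fac.δ * ∏ i, fac.factor i := by
  simp only [fac.factorization, Fintype.prod_sum_type, factor, Sum.elim_inl, Sum.elim_inr,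
    Finset.prod_mul_distrib, Finset.univ_unique, Finset.prod_singleton]
  ring

omit [NeZero m] in
theorem factor_dvd (i) : fac.factor i ∣ X ^ m - 1 :=
  fac.eq_C_mul_prod_factor ▸
    Dvd.dvd.mul_left (Finset.dvd_prod_of_mem _ (Finset.mem_univ i)) _

-- The product of two factors with different indices divides the separable polynomial `x^m - 1`,
-- which forces them to be coprime.
omit [NeZero m] in
theorem pairwise_isCoprime_factor (hm : (m : F) ≠ 0) :
    Pairwise fun i j => IsCoprime (fac.factor i) (fac.factor j) := by
  classical
  intro i j hij
  refine Separable.isCoprime (Separable.of_dvd (X_pow_sub_one_separable_iff.2 hm) ?_)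
  rw [fac.eq_C_mul_prod_factor, ← Finset.mul_prod_erase _ _ (Finset.mem_univ i)]
  exact Dvd.dvd.mul_left (mul_dvd_mul_left _ (Finset.dvd_prod_of_mem _
    (Finset.mem_erase.2 ⟨hij.symm, Finset.mem_univ j⟩))) _

end ReciprocalFactorization

/-- A quasi-cyclic code all of whose blocks sum to zero is Euclidean LCD if and only if its
constituents satisfy the conditions of `ConstituentsLCD`. -/
theorem isEuclideanLCD_iff_constituentsLCD (hm : (m : F) ≠ 0)
    (fac : ReciprocalFactorization F m r t) {D : Submodule F (Fin c × Fin m → F)}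
    (hD : ∀ j : Fin m, ∀ d ∈ D, (fun x => d (x.1, x.2 + j)) ∈ D)
    (h0 : ∀ d ∈ D, ∀ k, ∑ i, d (k, i) = 0) :
    IsEuclideanLCD D ↔ ConstituentsLCD fac D := by
  have hcop := fac.pairwise_isCoprime_factor hm
  obtain ⟨e, he, hsum⟩ :=
    exists_sum_mem_minIdeal_eq_one fac.δ_ne_zero fac.eq_C_mul_prod_factor hcop
  -- Conjugation acts on the index set by swapping the two copies of `Fin t` and fixing all else.
  have hτ : Function.Involutive
      (Sum.map id (Sum.map id Sum.swap) : Unit ⊕ (Fin r ⊕ (Fin t ⊕ Fin t)) → _) := by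
    rintro (_ | _ | _ | _) <;> rfl
  rw [isEuclideanLCD_iff_herm hD, forall_herm_iff_components hτ he hsum
    (fun i j hij a ha b hb => mul_eq_zero_of_mem_minIdeal (fac.factor_dvd i) (fac.factor_dvd j)
      (hcop hij) ha hb) ?_ (fun a v hv => smul_mem_map_phi hD a hv)]
  · simp only [ConstituentsLCD, constituent, inf_hermitianDualIn_eq_bot_iff,
      inf_euclideanDualIn_conjCode_eq_bot_iff]
    constructor
    · intro h
      exact ⟨fun i => h (.inr (.inl i)), fun j => h (.inr (.inr (.inr j))),
        fun j => h (.inr (.inr (.inl j)))⟩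
    · rintro ⟨h₁, h₂, h₃⟩ (_ | i | j | j)
      · exact fun u hu _ => eq_zero_of_mem_minIdeal_X_sub_one hm h0 hu
      · exact h₁ i
      · exact h₃ j
      · exact h₂ j
  · rintro (_ | i | j | j) a ha
    · exact conj_mem_minIdeal_X_sub_one ha
    · exact conj_mem_minIdeal_of_associated (fac.factor_dvd (.inr (.inl i)))
        (fac.associated_g i) ha
    · exact conj_mem_minIdeal_reverse (fac.factor_dvd (.inr (.inr (.inl j))))
        (fac.factor_dvd (.inr (.inr (.inr j)))) ha
    · exact conj_mem_minIdeal_of_reverse (fac.factor_dvd (.inr (.inr (.inl j))))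
        (fac.factor_dvd (.inr (.inr (.inr j)))) ha

end QuasiCyclic

end AQC
end

theorem mainTheorem9 {F : Type*} [Field F] [Fintype F] (p : ℕ) [CharP F p]
    (m c f : ℕ) [NeZero m] (hm : Nat.Coprime m (Fintype.card F))
    {r t : ℕ} (fac : AQC.ReciprocalFactorization F m r t)
    (C : Submodule F (AQC.Coord m c f → F)) (hC : AQC.IsPermAut (AQC.perm m c f) C) :
    (AQC.IsEuclideanLCD C ↔
      AQC.IsEuclideanLCD (AQC.fixedSubcode (AQC.perm m c f) C) ∧
        AQC.ConstituentsLCD fac (AQC.zeroSumPunctured C)) ∧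
    ((f = 0 ∨ m ≡ 1 [MOD p]) →
      (AQC.IsEuclideanLCD C ↔
        AQC.IsEuclideanLCD (AQC.projCode C) ∧
          AQC.ConstituentsLCD fac (AQC.zeroSumPunctured C))) := by
  -- The field order is a positive power of `p`, so `p ∣ m` would contradict coprimality.
  have hmF : (m : F) ≠ 0 := by
    intro h
    obtain ⟨n, hp, hcard⟩ := FiniteField.card F p
    have hdvd : p ∣ m := (CharP.cast_eq_zero_iff F p m).1 h
    have hdvd' : p ∣ Fintype.card F := hcard ▸ dvd_pow_self p n.ne_zero
    exact hp.ne_one (Nat.dvd_one.1 (hm ▸ Nat.dvd_gcd hdvd hdvd'))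
  have hmain : AQC.IsEuclideanLCD C ↔
      AQC.IsEuclideanLCD (AQC.fixedSubcode (AQC.perm m c f) C) ∧
        AQC.ConstituentsLCD fac (AQC.zeroSumPunctured C) := by
    rw [AQC.isEuclideanLCD_iff_fixedSubcode_zeroSumSubcode hmF hC,
      AQC.isEuclideanLCD_zeroSumSubcode_iff,
      AQC.isEuclideanLCD_iff_constituentsLCD hmF fac
        (fun j d hd => hC.rotate_zeroSumPunctured j hd)
        fun d hd => (AQC.mem_zeroSumPunctured.1 hd).2]
  exact ⟨hmain, fun h => by rw [hmain, AQC.isEuclideanLCD_projCode_iff p hmF h]⟩
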